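/- Let $(\Omega,\mathcal F,\mathbb P)$ be a nonatomic probability space, $X:\Omega\to\mathbb R^N$ and $Y:\Omega\to\mathbb R$ essentially bounded random variables with $\mathbb E(X)=0$. Consider the correlation maximization problem with a mean-independence constraint $$\text{(A)}\qquad \sup\{\mathbb E(VY)\;:\; V \text{ a random variable on } \Omega,\ \mathrm{Law}(V)=\mathrm{uniform}([0,1]),\ \mathbb E(X\mid V)=0\}$$ and the Koenker--Bassett $t$ by $t$ problem with the additional global constraint of monotonicity in $t$ $$\text{(B)}\qquad \sup\Big\{\mathbb E\Big(\int_0^1 U_tY\,dt\Big)\;:\; U_t\in[0,1],\ \mathbb E(U_t)=1-t,\ \mathbb E(U_tX)=0 \text{ for all } t\in[0,1],\ t\mapsto U_t \text{ nonincreasing on } [0,1]\Big\},$$ the supremum in (B) being over families $(U_t)_{t\in[0,1]}$ of random variables on $\Omega$, for which almost surely $U_t\in[0,1]$ for all $t\in[0,1]$ and $t\mapsto U_t$ is nonincreasing on $[0,1]$. Both problems have admissible elements, both suprema are finite, and $$\sup\text{(A)}=\sup\text{(B)}.$$ -/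

import Mathlib

open MeasureTheory

/-- A measure is nonatomic if every measurable set of positive measure has a measurable subset of
strictly smaller positive measure. (Mathlib's `NoAtoms` only says that singletons are null.) -/
def IsNonatomic {Ω : Type*} [MeasurableSpace Ω] (μ : Measure Ω) : Prop :=
  ∀ A : Set Ω, MeasurableSet A → 0 < μ A →
    ∃ B : Set Ω, B ⊆ A ∧ MeasurableSet B ∧ 0 < μ B ∧ μ B < μ A

/-- `V` is a random variable, uniformly distributed on `[0,1]`, from which `X` is
mean-independent: `E(X | V) = 0` (for a centered `X`). -/
structure IsMeanIndepUniform {Ω : Type*} [MeasurableSpace Ω] (P : Measure Ω) {N : ℕ}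
    (X : Ω → EuclideanSpace ℝ (Fin N)) (V : Ω → ℝ) : Prop where
  measurable : Measurable V
  law_eq : P.map V = volume.restrict (Set.Icc (0 : ℝ) 1)
  condExp_eq : P[X | MeasurableSpace.comap V (inferInstance : MeasurableSpace ℝ)] =ᵐ[P] 0

/-- The values `E(V Y)` of the correlation maximization problem with a mean-independence
constraint (univariate case). -/
def correlationValues {Ω : Type*} [MeasurableSpace Ω] (P : Measure Ω) {N : ℕ}
    (X : Ω → EuclideanSpace ℝ (Fin N)) (Y : Ω → ℝ) : Set ℝ :=
  {r | ∃ V : Ω → ℝ, IsMeanIndepUniform P X V ∧ r = ∫ ω, V ω * Y ω ∂P}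

/-- `(U t)`, `t ∈ [0,1]`, is a family of random variables that satisfies, for every `t`, the
constraints of the Koenker-Bassett problem of level `t`, and is nonincreasing in `t`. The values
of `U t` for `t` outside `[0,1]` are irrelevant. -/
structure IsMonotoneKB {Ω : Type*} [MeasurableSpace Ω] (P : Measure Ω) {N : ℕ}
    (X : Ω → EuclideanSpace ℝ (Fin N)) (U : ℝ → Ω → ℝ) : Prop where
  measurable : ∀ t ∈ Set.Icc (0 : ℝ) 1, Measurable (U t)
  antitone : ∀ᵐ ω ∂P, AntitoneOn (fun t => U t ω) (Set.Icc (0 : ℝ) 1)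
  mem_Icc : ∀ᵐ ω ∂P, ∀ t ∈ Set.Icc (0 : ℝ) 1, U t ω ∈ Set.Icc (0 : ℝ) 1
  integral_eq : ∀ t ∈ Set.Icc (0 : ℝ) 1, ∫ ω, U t ω ∂P = 1 - t
  integral_smul_eq : ∀ t ∈ Set.Icc (0 : ℝ) 1, ∫ ω, U t ω • X ω ∂P = 0

/-- The values `E(∫₀¹ U_t Y dt)` of the Koenker-Bassett problem with the global monotonicity
constraint. -/
def monotoneKBValues {Ω : Type*} [MeasurableSpace Ω] (P : Measure Ω) {N : ℕ}
    (X : Ω → EuclideanSpace ℝ (Fin N)) (Y : Ω → ℝ) : Set ℝ :=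
  {r | ∃ U : ℝ → Ω → ℝ, IsMonotoneKB P X U ∧
    r = ∫ ω, (∫ t in (0 : ℝ)..1, U t ω * Y ω) ∂P}

/-! If `V` is admissible for (A), the indicators of `{V > t}` are admissible for (B) and integrate
to `V` over `t ∈ [0,1]`, so the values of (A) are among those of (B).

Conversely, (B) is a relaxation: `U t` need not be an indicator. On a nonatomic space Lyapunov's
theorem replaces a `[0,1]`-valued density by a set without changing finitely many integrals. Applied
at the levels `k/K` inside previously chosen sets, it gives nested sets carrying the same integrals
of `1`, `Y` and the coordinates of `X` as `U (k/K)`. The function `c` counting these sets beyond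
level 0 makes `c/K` uniform on the grid and `E(cY)/K` a Riemann sum of `E(U_t Y)`.

Halving every cell of `c` repeatedly, in measure and in the integral of `X`, produces a uniform `V`
between `c/K` and `(c+1)/K` with `E(X | V) = 0` (`IsGridUniform.exists_isMeanIndepUniform`). With
`|Y| ≤ D`, discretizing `t` and replacing `c/K` by `V` cost `D/K` each; letting `K → ∞` equates the
suprema. -/

/-! ### Lyapunov's convexity theorem via extreme points -/

lemma IsNonatomic.exists_pairwise_disjoint {Ω : Type*} [MeasurableSpace Ω] {P : Measure Ω}
    [IsFiniteMeasure P] (hP : IsNonatomic P) (n : ℕ) {A : Set Ω} (hA : MeasurableSet A)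
    (hA0 : 0 < P A) :
    ∃ S : Fin n → Set Ω, Pairwise (Function.onFun Disjoint S) ∧
      ∀ i, S i ⊆ A ∧ MeasurableSet (S i) ∧ 0 < P (S i) := by
  induction n generalizing A with
  | zero => exact ⟨fun _ => ∅, fun i => i.elim0, fun i => i.elim0⟩
  | succ n ih =>
    obtain ⟨B, hBA, hB, hB0, hBlt⟩ := hP A hA hA0
    have hpos : 0 < P (A \ B) := by
      rw [measure_sdiff hBA hB.nullMeasurableSet (measure_ne_top P B)]
      exact tsub_pos_of_lt hBlt
    obtain ⟨S, hd, hS⟩ := ih (hA.diff hB) hpos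
    refine ⟨Fin.cons B S, ?_, ?_⟩
    · intro i j hij
      induction i using Fin.cases with
      | zero =>
        induction j using Fin.cases with
        | zero => exact absurd rfl hij
        | succ j =>
          exact (Set.disjoint_sdiff_right).mono_right (hS j).1
      | succ i =>
        induction j using Fin.cases with
        | zero => exact ((Set.disjoint_sdiff_right).mono_right (hS i).1).symm
        | succ j => exact hd (fun h => hij (congrArg Fin.succ h))
    · intro i
      induction i using Fin.cases with
      | zero => exact ⟨hBA, hB, hB0⟩
      | succ i => exact ⟨(hS i).1.trans Set.sdiff_subset, (hS i).2⟩

/-- On a set of positive measure of a nonatomic space there is a nonzero bounded function that is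
orthogonal to finitely many given integrable functions. -/
lemma IsNonatomic.exists_orthogonal {Ω ι : Type*} [MeasurableSpace Ω] {P : Measure Ω}
    [IsFiniteMeasure P] [Finite ι] (hP : IsNonatomic P) {f : ι → Ω → ℝ}
    (hf : ∀ i, Integrable (f i) P) {A : Set Ω} (hA : MeasurableSet A) (hA0 : 0 < P A) :
    ∃ h : Ω → ℝ, Measurable h ∧ (∀ ω, |h ω| ≤ 1) ∧ (∀ ω ∉ A, h ω = 0) ∧
      (∀ i, ∫ ω, h ω * f i ω ∂P = 0) ∧ ¬ h =ᵐ[P] 0 := by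
  have := Fintype.ofFinite ι
  obtain ⟨S, hd, hS⟩ := hP.exists_pairwise_disjoint (Fintype.card ι + 1) hA hA0
  let T : (Fin (Fintype.card ι + 1) → ℝ) →ₗ[ℝ] (ι → ℝ) :=
    LinearMap.pi fun i => Fintype.linearCombination ℝ (fun j => ∫ ω in S j, f i ω ∂P)
  -- There is one more coefficient than orthogonality conditions. A kernel vector, divided by its
  -- sup norm, gives a step function bounded by 1.
  have hker : LinearMap.ker T ≠ ⊥ := LinearMap.ker_ne_bot_of_finrank_lt (by simp)
  obtain ⟨c, hc, hc0⟩ := Submodule.exists_mem_ne_zero_of_ne_bot hker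
  obtain ⟨j₀, hj₀⟩ := Function.ne_iff.mp hc0
  have hn : 0 < ‖c‖ := norm_pos_iff.mpr hc0
  have hval : ∀ j, ∀ ω ∈ S j, ∑ k, (S k).indicator (fun _ => c k / ‖c‖) ω = c j / ‖c‖ := by
    intro j ω hω
    rw [Finset.sum_eq_single j, Set.indicator_of_mem hω]
    · intro k _ hk
      exact Set.indicator_of_notMem (fun h => (hd hk).le_bot ⟨h, hω⟩) _
    · simp
  have hout : ∀ ω, (∀ j, ω ∉ S j) → ∑ k, (S k).indicator (fun _ => c k / ‖c‖) ω = 0 :=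
    fun ω h => Finset.sum_eq_zero fun k _ => Set.indicator_of_notMem (h k) _
  refine ⟨fun ω => ∑ k, (S k).indicator (fun _ => c k / ‖c‖) ω, ?_, ?_, ?_, ?_, ?_⟩
  · exact Finset.measurable_sum _ fun k _ => measurable_const.indicator (hS k).2.1
  · intro ω
    by_cases h : ∃ j, ω ∈ S j
    · obtain ⟨j, hj⟩ := h
      simp only [hval j ω hj, abs_div, abs_norm]
      exact div_le_one_of_le₀ (by simpa using norm_le_pi_norm c j) hn.le
    · push Not at h
      simp [hout ω h]
  · exact fun ω hω => hout ω fun j hj => hω ((hS j).1 hj)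
  · intro i
    have hi : ∑ j, c j * ∫ ω in S j, f i ω ∂P = 0 := by
      have := congrFun (LinearMap.mem_ker.mp hc) i
      simpa [T, Fintype.linearCombination_apply] using this
    have : ∀ ω, (∑ k, (S k).indicator (fun _ => c k / ‖c‖) ω) * f i ω =
        ∑ k, (S k).indicator (fun ω => c k / ‖c‖ * f i ω) ω := by
      intro ω
      rw [Finset.sum_mul]
      exact Finset.sum_congr rfl fun k _ => by by_cases h : ω ∈ S k <;> simp [h]
    simp_rw [this]
    rw [integral_finsetSum _ fun k _ => ((hf i).const_mul _).indicator (hS k).2.1]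
    simp_rw [integral_indicator (hS _).2.1, integral_const_mul]
    rw [← mul_zero (1 / ‖c‖), ← hi, Finset.mul_sum]
    exact Finset.sum_congr rfl fun k _ => by ring
  · intro h
    have h0 : P (S j₀) = 0 := by
      refine measure_mono_null (fun ω hω => ?_) (ae_iff.mp h)
      simpa [hval j₀ ω hω, hn.ne'] using hj₀
    exact (hS j₀).2.2.ne' h0

/-- Lyapunov's convexity theorem: on a nonatomic space, a `[0,1]`-valued density can be replaced by
the indicator of a set without changing finitely many integrals. -/
theorem IsNonatomic.exists_setIntegral_eq {Ω ι : Type*} [MeasurableSpace Ω] {P : Measure Ω}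
    [IsFiniteMeasure P] [Finite ι] (hP : IsNonatomic P) {f : ι → Ω → ℝ}
    (hf : ∀ i, MemLp (f i) 2 P) {u : Ω → ℝ} (hu : Measurable u)
    (hu01 : ∀ ω, u ω ∈ Set.Icc (0 : ℝ) 1) :
    ∃ A : Set Ω, MeasurableSet A ∧ ∀ i, ∫ ω in A, f i ω ∂P = ∫ ω, u ω * f i ω ∂P := by
  -- Riesz representation places the densities in the weak-* dual, where Banach–Alaoglu gives
  -- compactness.
  let R : Lp ℝ 2 P → WeakDual ℝ (Lp ℝ 2 P) := fun w =>
    StrongDual.toWeakDual (InnerProductSpace.toDual ℝ (Lp ℝ 2 P) w)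
  have hRapp : ∀ (w g : Lp ℝ 2 P), R w g = inner ℝ w g := fun w g => rfl
  have hRs : ∀ (w : Lp ℝ 2 P) (s : Set Ω) (hs : MeasurableSet s),
      R w (indicatorConstLp 2 hs (measure_ne_top P s) 1) = ∫ ω in s, w ω ∂P := fun w s hs => by
    rw [hRapp, real_inner_comm, L2.inner_indicatorConstLp_one]
  have hRf : ∀ (w : Lp ℝ 2 P) i, R w ((hf i).toLp) = ∫ ω, w ω * f i ω ∂P := fun w i => by
    rw [hRapp, L2.inner_def]
    refine integral_congr_ae ?_
    filter_upwards [(hf i).coeFn_toLp] with ω hω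
    simp [hω, mul_comm]
  -- Testing on indicators expresses `0 ≤ w ≤ 1` a.e. by weak-* closed conditions.
  let K : Set (WeakDual ℝ (Lp ℝ 2 P)) := {φ | (∀ (s : Set Ω) (hs : MeasurableSet s),
      φ (indicatorConstLp 2 hs (measure_ne_top P s) 1) ∈ Set.Icc 0 (P.real s)) ∧
      ∀ i, φ ((hf i).toLp) = ∫ ω, u ω * f i ω ∂P}
  have hKiff : ∀ w : Lp ℝ 2 P, R w ∈ K ↔ (∀ᵐ ω ∂P, w ω ∈ Set.Icc (0 : ℝ) 1) ∧
      ∀ i, ∫ ω, w ω * f i ω ∂P = ∫ ω, u ω * f i ω ∂P := by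
    intro w
    have hwi : Integrable w P := (Lp.memLp w).integrable (by norm_num)
    simp only [K, Set.mem_ofPred_eq, hRs, hRf]
    refine and_congr_left fun _ => ⟨fun h => ?_, fun h s hs => ⟨?_, ?_⟩⟩
    · have h1 : 0 ≤ᵐ[P] w := ae_nonneg_of_forall_setIntegral_nonneg hwi
        fun s hs _ => (h s hs).1
      have h2 : 0 ≤ᵐ[P] fun ω => 1 - w ω := ae_nonneg_of_forall_setIntegral_nonneg
        ((integrable_const _).sub hwi) fun s hs _ => by
          rw [integral_sub (integrable_const _) hwi.integrableOn]
          simpa using (h s hs).2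
      filter_upwards [h1, h2] with ω h1 h2
      exact ⟨h1, by simpa using h2⟩
    · exact integral_nonneg_of_ae (ae_restrict_of_ae (h.mono fun ω h => h.1))
    · calc ∫ ω in s, w ω ∂P ≤ ∫ ω in s, (1 : ℝ) ∂P :=
            integral_mono_ae hwi.integrableOn (integrable_const _)
              (ae_restrict_of_ae (h.mono fun ω h => h.2))
        _ = P.real s := by simp
  have hRsurj : ∀ φ : WeakDual ℝ (Lp ℝ 2 P), ∃ w, R w = φ := fun φ =>
    ⟨(InnerProductSpace.toDual ℝ (Lp ℝ 2 P)).symm (WeakDual.toStrongDual φ), by simp [R]⟩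
  have hKclosed : IsClosed K := by
    refine IsClosed.inter (s₁ := {φ : WeakDual ℝ (Lp ℝ 2 P) | ∀ (s : Set Ω) (hs : MeasurableSet s),
      φ (indicatorConstLp 2 hs (measure_ne_top P s) 1) ∈ Set.Icc 0 (P.real s)}) ?_ ?_
    · simp only [Set.ofPred_forall]
      exact isClosed_iInter fun s => isClosed_iInter fun hs =>
        isClosed_Icc.preimage (WeakDual.eval_continuous _)
    · have := isClosed_iInter fun i => isClosed_eq (WeakDual.eval_continuous ((hf i).toLp))
        (continuous_const (y := ∫ ω, u ω * f i ω ∂P))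
      rwa [← Set.ofPred_forall] at this
  have hKcpt : IsCompact K := by
    refine (WeakDual.isCompact_closedBall (𝕜 := ℝ) (E := Lp ℝ 2 P) 0
      (P.real Set.univ ^ (2 : ENNReal).toReal⁻¹ * 1)).of_isClosed_subset hKclosed fun φ hφ => ?_
    obtain ⟨w, rfl⟩ := hRsurj φ
    simp only [Set.mem_preimage, Metric.mem_closedBall, dist_zero_right]
    change ‖InnerProductSpace.toDual ℝ (Lp ℝ 2 P) w‖ ≤ _
    rw [LinearIsometryEquiv.norm_map]
    refine Lp.norm_le_of_ae_bound zero_le_one ?_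
    filter_upwards [((hKiff w).mp hφ).1] with ω h
    simpa [abs_of_nonneg h.1] using h.2
  have humem : MemLp u 2 P := MemLp.of_bound hu.aestronglyMeasurable 1
    (ae_of_all _ fun ω => by simpa [abs_of_nonneg (hu01 ω).1] using (hu01 ω).2)
  have hKne : K.Nonempty := by
    refine ⟨R humem.toLp, (hKiff _).mpr ⟨?_, fun i => integral_congr_ae ?_⟩⟩
    · filter_upwards [humem.coeFn_toLp] with ω h
      exact h ▸ hu01 ω
    · filter_upwards [humem.coeFn_toLp] with ω h
      rw [h]
  have : LocallyConvexSpace ℝ (WeakDual ℝ (Lp ℝ 2 P)) := WeakBilin.locallyConvexSpace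
  obtain ⟨φ, hφ⟩ := hKcpt.extremePoints_nonempty hKne
  obtain ⟨w, rfl⟩ := hRsurj φ
  rw [mem_extremePoints] at hφ
  obtain ⟨hwK, hext⟩ := hφ
  obtain ⟨hw01, hwf⟩ := (hKiff w).mp hwK
  have hwm : Measurable w := (Lp.stronglyMeasurable w).measurable
  -- An extreme `w` has no intermediate values: an orthogonal `h` supported on this set would make
  -- `w` the midpoint of the two feasible densities `w ± h / (n + 1)`.
  have hmid : ∀ n : ℕ, P {ω | 1 / (n + 1 : ℝ) ≤ w ω ∧ w ω ≤ 1 - 1 / (n + 1 : ℝ)} = 0 := by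
    intro n
    by_contra hne
    obtain ⟨h, hhm, hh1, hh0, hhf, hhne⟩ := hP.exists_orthogonal
      (fun i => (hf i).integrable (by norm_num))
      ((measurableSet_le measurable_const hwm).inter (measurableSet_le hwm measurable_const))
      (pos_iff_ne_zero.mpr hne)
    have hhL : MemLp h 2 P := MemLp.of_bound hhm.aestronglyMeasurable 1
      (ae_of_all _ fun ω => by simpa using hh1 ω)
    let δ : ℝ := 1 / (n + 1 : ℝ)
    have hδ : 0 < δ := by positivity
    have hmem : ∀ ε : ℝ, |ε| = δ → R (w + ε • hhL.toLp) ∈ K := by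
      intro ε hε
      have hco : ∀ᵐ ω ∂P, (w + ε • hhL.toLp : Lp ℝ 2 P) ω = w ω + ε * h ω := by
        filter_upwards [Lp.coeFn_add w (ε • hhL.toLp), Lp.coeFn_smul ε hhL.toLp,
          hhL.coeFn_toLp] with ω h1 h2 h3
        rw [h1, Pi.add_apply, h2, Pi.smul_apply, h3, smul_eq_mul]
      refine (hKiff _).mpr ⟨?_, fun i => ?_⟩
      · filter_upwards [hco, hw01] with ω hω h01
        rw [hω]
        by_cases hA : ω ∈ {ω | 1 / (n + 1 : ℝ) ≤ w ω ∧ w ω ≤ 1 - 1 / (n + 1 : ℝ)}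
        · have hle : |ε * h ω| ≤ δ := by
            rw [abs_mul, hε]
            exact mul_le_of_le_one_right hδ.le (hh1 ω)
          have h2 := abs_le.mp hle
          have h3 : δ ≤ w ω ∧ w ω ≤ 1 - δ := hA
          exact ⟨by linarith [h2.1, h3.1], by linarith [h2.2, h3.2]⟩
        · rw [hh0 ω hA]
          simpa using h01
      · have h1 : Integrable (fun ω => w ω * f i ω) P :=
          MemLp.integrable_mul (Lp.memLp w) (hf i)
        have h2 : Integrable (fun ω => ε * (h ω * f i ω)) P :=
          (MemLp.integrable_mul hhL (hf i)).const_mul ε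
        rw [← hwf i, ← add_zero (∫ ω, w ω * f i ω ∂P), ← mul_zero ε, ← hhf i,
          ← integral_const_mul, ← integral_add h1 h2]
        refine integral_congr_ae ?_
        filter_upwards [hco] with ω hω
        rw [hω]; ring
    have hseg : R w ∈ openSegment ℝ (R (w + δ • hhL.toLp)) (R (w + (-δ) • hhL.toLp)) := by
      refine ⟨1 / 2, 1 / 2, by norm_num, by norm_num, by norm_num, ?_⟩
      refine DFunLike.ext _ _ fun g => ?_
      change (1 / 2 : ℝ) * R (w + δ • hhL.toLp) g + (1 / 2 : ℝ) * R (w + (-δ) • hhL.toLp) g = R w g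
      have hlin : ∀ ε : ℝ, R (w + ε • hhL.toLp) g = R w g + ε * R hhL.toLp g := fun ε => by
        rw [hRapp, hRapp, hRapp, inner_add_left, real_inner_smul_left]
      rw [hlin, hlin]
      ring
    have heq := (hext _ (hmem δ (abs_of_pos hδ)) _ (hmem (-δ) (by rw [abs_neg, abs_of_pos hδ]))
      hseg).1
    have heq' : w + δ • hhL.toLp = w :=
      (InnerProductSpace.toDual ℝ (Lp ℝ 2 P)).injective (StrongDual.toWeakDual.injective heq)
    have hz : hhL.toLp = 0 := by
      simpa [hδ.ne'] using heq'
    apply hhne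
    have := hhL.coeFn_toLp
    rw [hz] at this
    exact this.symm.trans (Lp.coeFn_zero _ _ _)
  have h01 : ∀ᵐ ω ∂P, w ω = 0 ∨ w ω = 1 := by
    have : ∀ᵐ ω ∂P, ∀ n : ℕ, ¬ (1 / (n + 1 : ℝ) ≤ w ω ∧ w ω ≤ 1 - 1 / (n + 1 : ℝ)) :=
      ae_all_iff.mpr fun n => by simpa [ae_iff] using hmid n
    filter_upwards [this, hw01] with ω hω h
    by_contra! hcon
    have hp : 0 < min (w ω) (1 - w ω) :=
      lt_min (lt_of_le_of_ne h.1 hcon.1.symm) (sub_pos.mpr (lt_of_le_of_ne h.2 hcon.2))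
    obtain ⟨n, hn⟩ := exists_nat_one_div_lt hp
    exact hω n ⟨(hn.trans_le (min_le_left _ _)).le, by
      linarith [hn.trans_le (min_le_right _ _)]⟩
  have hAm : MeasurableSet {ω | w ω = 1} := hwm (measurableSet_singleton 1)
  refine ⟨{ω | w ω = 1}, hAm, fun i => ?_⟩
  rw [← hwf i, ← integral_indicator hAm]
  refine integral_congr_ae ?_
  filter_upwards [h01] with ω hω
  rcases hω with h | h <;> simp [Set.indicator, h]

/-! ### Nested sets matching a decreasing sequence of densities -/

lemma EuclideanSpace.integral_apply {Ω : Type*} [MeasurableSpace Ω] {μ : Measure Ω} {N : ℕ}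
    {X : Ω → EuclideanSpace ℝ (Fin N)} (hX : Integrable X μ) (i : Fin N) :
    (∫ ω, X ω ∂μ) i = ∫ ω, X ω i ∂μ :=
  ((EuclideanSpace.proj i : EuclideanSpace ℝ (Fin N) →L[ℝ] ℝ).integral_comp_comm hX).symm

/-- The superlevel sets of an integer valued function can match a nonincreasing sequence of
`[0,1]`-valued densities in finitely many integrals. -/
theorem IsNonatomic.exists_superlevel_setIntegral_eq {Ω ι : Type*} [MeasurableSpace Ω]
    {P : Measure Ω} [IsFiniteMeasure P] [Finite ι] (hP : IsNonatomic P) {f : ι → Ω → ℝ}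
    (hf : ∀ i, MemLp (f i) 2 P) (K : ℕ) {U : ℕ → Ω → ℝ} (hU : ∀ k ≤ K, Measurable (U k))
    (hU0 : ∀ᵐ ω ∂P, U 0 ω = 1) (hUK : ∀ k < K, ∀ᵐ ω ∂P, 0 ≤ U (k + 1) ω ∧ U (k + 1) ω ≤ U k ω) :
    ∃ c : Ω → ℕ, Measurable c ∧ (∀ ω, c ω ≤ K) ∧
      ∀ k ≤ K, ∀ i, ∫ ω in {ω | k ≤ c ω}, f i ω ∂P = ∫ ω, U k ω * f i ω ∂P := by
  induction K generalizing ι f with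
  | zero =>
    refine ⟨fun _ => 0, measurable_const, fun _ => le_rfl, fun k hk i => ?_⟩
    obtain rfl : k = 0 := by omega
    simp only [le_refl, Set.ofPred_true, Measure.restrict_univ]
    refine integral_congr_ae ?_
    filter_upwards [hU0] with ω h
    rw [h, one_mul]
  | succ K ih =>
    -- The proportion of `U K` to keep. Where `U K` vanishes so does `U (K + 1)` a.e., so `0 / 0 =
    -- 0` is harmless; the truncation gives bounds everywhere, not just a.e.
    let u : Ω → ℝ := fun ω => max 0 (min 1 (U (K + 1) ω / U K ω))
    have hu : Measurable u :=
      measurable_const.max (measurable_const.min ((hU _ le_rfl).div (hU K (by omega))))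
    have hu01 : ∀ ω, u ω ∈ Set.Icc (0 : ℝ) 1 := fun ω =>
      ⟨le_max_left _ _, max_le zero_le_one (min_le_left _ _)⟩
    have huU : ∀ᵐ ω ∂P, U K ω * u ω = U (K + 1) ω := by
      filter_upwards [hUK K (by omega)] with ω h
      rcases eq_or_lt_of_le (h.1.trans h.2) with h0 | h0
      · rw [← h0, zero_mul]
        exact le_antisymm h.1 (h0 ▸ h.2)
      · have h1 : U (K + 1) ω / U K ω ≤ 1 := div_le_one_of_le₀ h.2 h0.le
        have h2 : 0 ≤ U (K + 1) ω / U K ω := div_nonneg h.1 h0.le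
        simp only [u, min_eq_right h1, max_eq_right h2]
        field_simp
    have huf : ∀ i, MemLp (fun ω => u ω * f i ω) 2 P := fun i =>
      (hf i).of_le (hu.aestronglyMeasurable.mul (hf i).1) (ae_of_all _ fun ω => by
        rw [norm_mul, Real.norm_of_nonneg (hu01 ω).1]
        exact mul_le_of_le_one_left (norm_nonneg _) (hu01 ω).2)
    -- Adding the test functions `u * f i` makes the top set reproduce the integrals of `U K * u * f
    -- i = U (K + 1) * f i`; Lyapunov's theorem with density `u` then cuts the next set out of it.
    obtain ⟨c, hc, hcK, hcf⟩ := ih (f := Sum.elim f fun i ω => u ω * f i ω)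
      (by rintro (i | i); exacts [hf i, huf i]) (fun k hk => hU k (by omega))
      (fun k hk => hUK k (by omega))
    have hKm : MeasurableSet {ω | K ≤ c ω} := hc measurableSet_Ici
    obtain ⟨B, hB, hBf⟩ := hP.exists_setIntegral_eq
      (f := fun i => {ω | K ≤ c ω}.indicator (f i)) (fun i => (hf i).indicator hKm) hu hu01
    have hBK : ∀ i, ∫ ω in B ∩ {ω | K ≤ c ω}, f i ω ∂P = ∫ ω, U (K + 1) ω * f i ω ∂P := by
      intro i
      have h1 := hBf i
      rw [setIntegral_indicator hKm] at h1
      rw [h1]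
      have h2 := hcf K le_rfl (Sum.inr i)
      simp only [Sum.elim_inr] at h2
      rw [← integral_indicator hKm] at h2
      calc _ = ∫ ω, {ω | K ≤ c ω}.indicator (fun ω => u ω * f i ω) ω ∂P := by
            congr 1; ext ω; by_cases h : K ≤ c ω <;> simp [Set.indicator, h]
        _ = _ := h2
        _ = _ := by
            refine integral_congr_ae ?_
            filter_upwards [huU] with ω h
            rw [← h, mul_assoc]
    classical
    refine ⟨fun ω => c ω + (B ∩ {ω | K ≤ c ω}).indicator (fun _ => 1) ω,
      hc.add (measurable_const.indicator (hB.inter hKm)), fun ω => ?_, fun k hk i => ?_⟩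
    · have := hcK ω
      simp only [Set.indicator_apply]
      split_ifs <;> omega
    · rcases hk.lt_or_eq with hk | rfl
      · have : {ω | k ≤ c ω + (B ∩ {ω | K ≤ c ω}).indicator (fun _ => 1) ω} = {ω | k ≤ c ω} := by
          ext ω
          simp only [Set.mem_ofPred_eq, Set.indicator_apply, Set.mem_inter_iff]
          split_ifs <;> omega
        rw [this]
        exact hcf k (by omega) (Sum.inl i)
      · have : {ω | K + 1 ≤ c ω + (B ∩ {ω | K ≤ c ω}).indicator (fun _ => 1) ω} =
            B ∩ {ω | K ≤ c ω} := by
          ext ω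
          have := hcK ω
          simp only [Set.mem_ofPred_eq, Set.indicator_apply, Set.mem_inter_iff]
          split_ifs with h
          · simp only [h, and_self, iff_true]; omega
          · simp only [h, iff_false]; omega
        rw [this, hBK]

/-! ### Dyadic refinement of a grid variable to a uniform one -/

/-- `a / m` is uniformly distributed on the grid of mesh `1 / m` and `X` is mean-independent of
it; both expressed through superlevel sets. -/
structure IsGridUniform {Ω : Type*} [MeasurableSpace Ω] (P : Measure Ω) {N : ℕ}
    (X : Ω → EuclideanSpace ℝ (Fin N)) (m : ℕ) (a : Ω → ℕ) : Prop where
  measurable : Measurable a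
  le : ∀ ω, a ω ≤ m
  measureReal_eq : ∀ k ≤ m, P.real {ω | k ≤ a ω} = 1 - k / m
  setIntegral_eq : ∀ k ≤ m, ∫ ω in {ω | k ≤ a ω}, X ω ∂P = 0

/-- Lyapunov's theorem with constant density `1/2`, tested on `1` and the coordinates of `X`
restricted to each of the finitely many cells, so that one set halves all cells at once. -/
lemma IsNonatomic.exists_halving {Ω : Type*} [MeasurableSpace Ω] {P : Measure Ω}
    [IsFiniteMeasure P] (hP : IsNonatomic P) {N : ℕ} {X : Ω → EuclideanSpace ℝ (Fin N)}
    (hX : MemLp X 2 P) {a : Ω → ℕ} (ha : Measurable a) {m : ℕ} (ham : ∀ ω, a ω ≤ m) :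
    ∃ B : Set Ω, MeasurableSet B ∧ ∀ j, P.real (B ∩ {ω | a ω = j}) = P.real {ω | a ω = j} / 2 ∧
      ∫ ω in B ∩ {ω | a ω = j}, X ω ∂P = (1 / 2 : ℝ) • ∫ ω in {ω | a ω = j}, X ω ∂P := by
  have hm : ∀ j, MeasurableSet {ω | a ω = j} := fun j => ha (measurableSet_singleton j)
  have hXi : Integrable X P := hX.integrable (by norm_num)
  have hXc : ∀ i, MemLp (fun ω => X ω i) 2 P := fun i =>
    hX.of_le ((EuclideanSpace.proj i : EuclideanSpace ℝ (Fin N) →L[ℝ] ℝ).continuous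
      |>.comp_aestronglyMeasurable hX.1) (ae_of_all _ fun ω => PiLp.norm_apply_le (X ω) i)
  let g : Option (Fin N) → Ω → ℝ := fun o => o.elim (fun _ => 1) fun i ω => X ω i
  have hg : ∀ o, MemLp (g o) 2 P := by
    rintro (_ | i)
    exacts [memLp_const 1, hXc i]
  obtain ⟨B, hB, hBf⟩ := hP.exists_setIntegral_eq (u := fun _ => 1 / 2)
    (f := fun p : Option (Fin N) × Fin (m + 1) => {ω | a ω = p.2}.indicator (g p.1))
    (fun p => (hg p.1).indicator (hm p.2)) measurable_const
    (fun _ => ⟨by norm_num, by norm_num⟩)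
  have key : ∀ j o, ∫ ω in B ∩ {ω | a ω = j}, g o ω ∂P =
      1 / 2 * ∫ ω in {ω | a ω = j}, g o ω ∂P := by
    intro j o
    by_cases hj : j < m + 1
    · have h := hBf (o, ⟨j, hj⟩)
      simp only at h
      rwa [setIntegral_indicator (hm j), integral_const_mul, integral_indicator (hm j)] at h
    · have : {ω | a ω = j} = ∅ := by
        ext ω
        have := ham ω
        simp only [Set.mem_ofPred_eq, Set.mem_empty_iff_false, iff_false]
        omega
      simp [this]
  refine ⟨B, hB, fun j => ⟨?_, ?_⟩⟩
  · have := key j none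
    simp [g] at this
    linarith
  · ext i
    have := key j (some i)
    simp only [g, Option.elim] at this
    rw [EuclideanSpace.integral_apply hXi.integrableOn, this, PiLp.smul_apply,
      EuclideanSpace.integral_apply hXi.integrableOn, smul_eq_mul]

lemma IsGridUniform.exists_refinement {Ω : Type*} [MeasurableSpace Ω] {P : Measure Ω}
    [IsFiniteMeasure P] (hP : IsNonatomic P) {N : ℕ} {X : Ω → EuclideanSpace ℝ (Fin N)}
    (hX : MemLp X 2 P) {a : Ω → ℕ} {m : ℕ} (hm : 0 < m) (ha : IsGridUniform P X m a) :
    ∃ b : Ω → ℕ, IsGridUniform P X (2 * m) b ∧ ∀ ω, 2 * a ω ≤ b ω ∧ b ω ≤ 2 * a ω + 1 := by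
  classical
  obtain ⟨B, hB, hBa⟩ := hP.exists_halving hX ha.measurable ha.le
  have hXi : Integrable X P := hX.integrable (by norm_num)
  have hm0 : (m : ℝ) ≠ 0 := by positivity
  have hmj : ∀ j, MeasurableSet {ω | a ω = j} := fun j => ha.measurable (measurableSet_singleton j)
  -- The minimum acts only on the null set `{a = m}`, where `2 * a + 1` would exceed the grid.
  let b : Ω → ℕ := fun ω => min (2 * m) (2 * a ω + B.indicator (fun _ => 1) ω)
  have heven : ∀ j ≤ m, {ω | 2 * j ≤ b ω} = {ω | j ≤ a ω} := by
    intro j hj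
    ext ω
    simp only [b, Set.mem_ofPred_eq, Set.indicator_apply]
    split_ifs <;> omega
  have hodd : ∀ j < m, {ω | 2 * j + 1 ≤ b ω} = {ω | j + 1 ≤ a ω} ∪ (B ∩ {ω | a ω = j}) := by
    intro j hj
    ext ω
    simp only [b, Set.mem_ofPred_eq, Set.indicator_apply, Set.mem_union, Set.mem_inter_iff]
    split_ifs with h
    · simp only [h, true_and]; omega
    · simp only [h, false_and, or_false]; omega
  have hsplit : ∀ j, {ω | j ≤ a ω} = {ω | j + 1 ≤ a ω} ∪ {ω | a ω = j} := by
    intro j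
    ext ω
    simp only [Set.mem_ofPred_eq, Set.mem_union]
    omega
  have hdisj : ∀ j, Disjoint {ω | j + 1 ≤ a ω} {ω | a ω = j} := fun j =>
    Set.disjoint_left.mpr fun ω h1 h2 => by simp only [Set.mem_ofPred_eq] at h1 h2; omega
  have hdisj' : ∀ j, Disjoint {ω | j + 1 ≤ a ω} (B ∩ {ω | a ω = j}) := fun j =>
    (hdisj j).mono_right Set.inter_subset_right
  refine ⟨b, ⟨?_, fun ω => min_le_left _ _, fun k hk => ?_, fun k hk => ?_⟩, fun ω => ?_⟩
  · exact measurable_const.min ((ha.measurable.const_mul 2).add (measurable_const.indicator hB))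
  · obtain ⟨j, rfl | rfl⟩ := Nat.even_or_odd' k
    · rw [heven j (by omega), ha.measureReal_eq j (by omega)]
      push_cast
      rw [mul_div_mul_left _ _ two_ne_zero]
    · have h1 := ha.measureReal_eq (j + 1) (by omega)
      have h2 := ha.measureReal_eq j (by omega)
      rw [hsplit j, measureReal_union (hdisj j) (hmj j), h1] at h2
      rw [hodd j (by omega), measureReal_union (hdisj' j) (hB.inter (hmj j)), h1, (hBa j).1]
      push_cast at h2 ⊢
      field_simp at h2 ⊢
      linarith
  · obtain ⟨j, rfl | rfl⟩ := Nat.even_or_odd' k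
    · rw [heven j (by omega), ha.setIntegral_eq j (by omega)]
    · have h1 := ha.setIntegral_eq (j + 1) (by omega)
      have h2 := ha.setIntegral_eq j (by omega)
      rw [hsplit j, setIntegral_union (hdisj j) (hmj j) hXi.integrableOn hXi.integrableOn, h1,
        zero_add] at h2
      rw [hodd j (by omega), setIntegral_union (hdisj' j) (hB.inter (hmj j)) hXi.integrableOn
        hXi.integrableOn, h1, (hBa j).2, h2, smul_zero, zero_add]
  · have := ha.le ω
    simp only [b, Set.indicator_apply]
    split_ifs <;> omega

lemma IsGridUniform.exists_refinement_seq {Ω : Type*} [MeasurableSpace Ω] {P : Measure Ω}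
    [IsFiniteMeasure P] (hP : IsNonatomic P) {N : ℕ} {X : Ω → EuclideanSpace ℝ (Fin N)}
    (hX : MemLp X 2 P) {c : Ω → ℕ} {K : ℕ} (hK : 0 < K) (hc : IsGridUniform P X K c) :
    ∃ a : ℕ → Ω → ℕ, a 0 = c ∧ (∀ n, IsGridUniform P X (K * 2 ^ n) (a n)) ∧
      ∀ n ω, 2 * a n ω ≤ a (n + 1) ω ∧ a (n + 1) ω ≤ 2 * a n ω + 1 := by
  have step : ∀ n (a : {a // IsGridUniform P X (K * 2 ^ n) a}),
      ∃ b : {b // IsGridUniform P X (K * 2 ^ (n + 1)) b},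
        ∀ ω, 2 * a.1 ω ≤ b.1 ω ∧ b.1 ω ≤ 2 * a.1 ω + 1 := fun n a => by
    obtain ⟨b, hb, hab⟩ := a.2.exists_refinement hP hX (by positivity)
    exact ⟨⟨b, by rwa [show K * 2 ^ (n + 1) = 2 * (K * 2 ^ n) by ring]⟩, hab⟩
  choose g hg using step
  let s : (n : ℕ) → {a // IsGridUniform P X (K * 2 ^ n) a} :=
    fun n => Nat.rec ⟨c, by simpa using hc⟩ g n
  exact ⟨fun n => (s n).1, rfl, fun n => (s n).2, fun n ω => hg n (s n) ω⟩

/-- A grid-uniform variable can be refined to a uniform one that is still mean-independent. -/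
theorem IsGridUniform.exists_isMeanIndepUniform {Ω : Type*} [MeasurableSpace Ω] {P : Measure Ω}
    [IsProbabilityMeasure P] (hP : IsNonatomic P) {N : ℕ} {X : Ω → EuclideanSpace ℝ (Fin N)}
    (hXm : Measurable X) {C : ℝ} (hXC : ∀ᵐ ω ∂P, ‖X ω‖ ≤ C) {c : Ω → ℕ} {K : ℕ} (hK : 0 < K)
    (hc : IsGridUniform P X K c) :
    ∃ V : Ω → ℝ, IsMeanIndepUniform P X V ∧ ∀ ω, (c ω : ℝ) / K ≤ V ω ∧ V ω ≤ (c ω + 1) / K := by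
  have hX2 : MemLp X 2 P := MemLp.of_bound hXm.aestronglyMeasurable C hXC
  have hXi : Integrable X P := hX2.integrable (by norm_num)
  obtain ⟨a, ha0, ha, hstep⟩ := hc.exists_refinement_seq hP hX2 hK
  let m : ℕ → ℕ := fun n => K * 2 ^ n
  have hm : ∀ n, (0 : ℝ) < m n := fun n => by positivity
  have hmS : ∀ n, (m (n + 1) : ℝ) = 2 * m n := fun n => by simp only [m]; push_cast; ring
  have hmtop : Filter.Tendsto (fun n => 1 / (m n : ℝ)) Filter.atTop (nhds 0) := by
    have h := (tendsto_pow_atTop_nhds_zero_of_lt_one (r := (1 / 2 : ℝ)) (by norm_num)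
      (by norm_num)).const_mul (1 / (K : ℝ))
    rw [mul_zero] at h
    refine h.congr fun n => ?_
    simp only [m]; push_cast; rw [one_div_pow]; field_simp
  have hmono : ∀ ω, Monotone fun n => (a n ω : ℝ) / m n := fun ω =>
    monotone_nat_of_le_succ fun n => by
      have h : (2 * a n ω : ℝ) ≤ a (n + 1) ω := by exact_mod_cast (hstep n ω).1
      rw [hmS, ← mul_div_mul_left (a n ω : ℝ) _ two_ne_zero]
      have := hm n
      gcongr
  have hanti : ∀ ω, Antitone fun n => (a n ω + 1 : ℝ) / m n := fun ω =>
    antitone_nat_of_succ_le fun n => by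
      have h : (a (n + 1) ω : ℝ) ≤ 2 * a n ω + 1 := by exact_mod_cast (hstep n ω).2
      rw [hmS, ← mul_div_mul_left (a n ω + 1 : ℝ) _ two_ne_zero]
      have := hm n
      gcongr
      linarith
  have hcross : ∀ ω k n, (a k ω : ℝ) / m k ≤ (a n ω + 1) / m n := fun ω k n =>
    calc (a k ω : ℝ) / m k ≤ a (max k n) ω / m (max k n) := hmono ω (le_max_left k n)
      _ ≤ (a (max k n) ω + 1) / m (max k n) := by
        have := hm (max k n)
        gcongr
        linarith
      _ ≤ (a n ω + 1) / m n := hanti ω (le_max_right k n)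
  -- The common point of the nested intervals `[a n / m n, (a n + 1) / m n]`.
  let V : Ω → ℝ := fun ω => ⨆ n, (a n ω : ℝ) / m n
  have hVm : Measurable V := Measurable.iSup fun n =>
    (measurable_from_nat.comp (ha n).measurable).div_const _
  have hlow : ∀ ω n, (a n ω : ℝ) / m n ≤ V ω := fun ω n =>
    le_ciSup (f := fun n => (a n ω : ℝ) / m n) ⟨_, by
      rintro _ ⟨k, rfl⟩; exact hcross ω k 0⟩ n
  have hup : ∀ ω n, V ω ≤ (a n ω + 1) / m n := fun ω n => ciSup_le fun k => hcross ω k n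
  -- superlevel sets of `V` are approximated from inside by those of `a n`
  have hin : ∀ (x : ℝ) n, {ω | ⌈x * m n⌉₊ ≤ a n ω} ⊆ {ω | x ≤ V ω} := fun x n ω h => by
    refine le_trans ?_ (hlow ω n)
    rw [le_div_iff₀ (hm n)]
    exact (Nat.le_ceil _).trans (Nat.cast_le.mpr h)
  have hout : ∀ x n, {ω | x ≤ V ω} ⊆ {ω | ⌈x * m n⌉₊ - 1 ≤ a n ω} := fun x n ω h => by
    have h1 : x * m n ≤ a n ω + 1 := (le_div_iff₀ (hm n)).mp (h.trans (hup ω n))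
    have : ⌈x * m n⌉₊ ≤ a n ω + 1 := Nat.ceil_le.mpr (by exact_mod_cast h1)
    simp only [Set.mem_ofPred_eq]
    omega
  have hceil : ∀ x ∈ Set.Icc (0 : ℝ) 1, ∀ n, ⌈x * m n⌉₊ ≤ m n := fun x hx n =>
    Nat.ceil_le.mpr (mul_le_of_le_one_left (hm n).le hx.2)
  have hPin : ∀ x ∈ Set.Icc (0 : ℝ) 1, ∀ n,
      1 - x - 1 / m n ≤ P.real {ω | ⌈x * m n⌉₊ ≤ a n ω} := fun x hx n => by
    rw [(ha n).measureReal_eq _ (hceil x hx n)]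
    have h := (Nat.ceil_lt_add_one (mul_nonneg hx.1 (hm n).le)).le
    have h' : (⌈x * m n⌉₊ : ℝ) / m n ≤ (x * m n + 1) / m n := by
      have := hm n
      gcongr
    rw [add_div, mul_div_cancel_right₀ _ (hm n).ne'] at h'
    change _ ≤ 1 - (⌈x * m n⌉₊ : ℝ) / m n
    linarith
  have hPout : ∀ x ∈ Set.Icc (0 : ℝ) 1, ∀ n, P.real {ω | x ≤ V ω} ≤ 1 - x + 1 / m n :=
    fun x hx n => by
      refine (measureReal_mono (hout x n)).trans ?_
      rw [(ha n).measureReal_eq _ ((Nat.sub_le _ _).trans (hceil x hx n))]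
      have h1 : (⌈x * m n⌉₊ : ℝ) ≤ (⌈x * m n⌉₊ - 1 : ℕ) + 1 := by
        exact_mod_cast (by omega : ⌈x * m n⌉₊ ≤ ⌈x * m n⌉₊ - 1 + 1)
      have h2 : x - 1 / m n ≤ ((⌈x * m n⌉₊ - 1 : ℕ) : ℝ) / m n := by
        rw [le_div_iff₀ (hm n), sub_mul, one_div_mul_cancel (hm n).ne']
        linarith [Nat.le_ceil (x * m n)]
      change 1 - ((⌈x * m n⌉₊ - 1 : ℕ) : ℝ) / m n ≤ _
      linarith
  have hPV : ∀ x ∈ Set.Icc (0 : ℝ) 1, P.real {ω | x ≤ V ω} = 1 - x := fun x hx => by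
    refine le_antisymm ?_ ?_
    · have h := (tendsto_const_nhds (x := 1 - x)).add hmtop
      rw [add_zero] at h
      exact ge_of_tendsto' h (hPout x hx)
    · have h := (tendsto_const_nhds (x := 1 - x)).sub hmtop
      rw [sub_zero] at h
      exact le_of_tendsto' h fun n => (hPin x hx n).trans (measureReal_mono (hin x n))
  have hXV : ∀ x ∈ Set.Icc (0 : ℝ) 1, ∫ ω in {ω | x ≤ V ω}, X ω ∂P = 0 := fun x hx => by
    -- `X` integrates to zero over the inner grid set, and what remains has measure at most `1 / m
    -- n`.
    have hbound : ∀ n, ‖∫ ω in {ω | x ≤ V ω}, X ω ∂P‖ ≤ |C| * (1 / m n) := fun n => by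
      have hF : MeasurableSet {ω | ⌈x * m n⌉₊ ≤ a n ω} := (ha n).measurable measurableSet_Ici
      rw [← Set.sdiff_union_of_subset (hin x n), setIntegral_union Set.disjoint_sdiff_left hF
        hXi.integrableOn hXi.integrableOn, (ha n).setIntegral_eq _ (hceil x hx n), add_zero]
      refine (norm_setIntegral_le_of_norm_le_const_ae (C := |C|) (measure_lt_top _ _)
        (ae_restrict_of_ae (hXC.mono fun ω h => h.trans (le_abs_self C)))).trans ?_
      refine mul_le_mul_of_nonneg_left ?_ (abs_nonneg C)
      rw [measureReal_sdiff (hin x n) hF, hPV x hx]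
      linarith [hPin x hx n]
    have h := hmtop.const_mul |C|
    rw [mul_zero] at h
    exact norm_le_zero_iff.mp (ge_of_tendsto' h hbound)
  have hV0 : ∀ ω, 0 ≤ V ω := fun ω => le_trans (by positivity) (hlow ω 0)
  have hlt : ∀ x < 0, {ω | x ≤ V ω} = {ω | 0 ≤ V ω} := fun x hx => by
    ext ω; simp [hV0 ω, hx.le.trans (hV0 ω)]
  have hgt : ∀ x > 1, P {ω | x ≤ V ω} = 0 := fun x hx => by
    refine measure_mono_null (t := {ω | 1 ≤ V ω}) (fun ω h => hx.le.trans h) ?_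
    have := hPV 1 ⟨zero_le_one, le_rfl⟩
    rwa [sub_self, measureReal_eq_zero_iff] at this
  have hXV' : ∀ x, ∫ ω in {ω | x ≤ V ω}, X ω ∂P = 0 := fun x => by
    rcases lt_or_ge x 0 with h | h
    · rw [hlt x h]
      exact hXV 0 ⟨le_rfl, zero_le_one⟩
    · rcases le_or_gt x 1 with h1 | h1
      · exact hXV x ⟨h, h1⟩
      · exact setIntegral_measure_zero _ (hgt x h1)
  refine ⟨V, ⟨hVm, ?_, ?_⟩, fun ω => ?_⟩
  · have := Measure.isProbabilityMeasure_map (μ := P) hVm.aemeasurable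
    refine Measure.ext_of_Ici _ _ fun x => ?_
    rw [Measure.map_apply hVm measurableSet_Ici, Measure.restrict_apply measurableSet_Ici]
    change P {ω | x ≤ V ω} = _
    rcases lt_or_ge x 0 with h | h
    · have hI : Set.Ici x ∩ Set.Icc (0 : ℝ) 1 = Set.Icc 0 1 :=
        Set.inter_eq_right.mpr fun y hy => h.le.trans hy.1
      rw [hlt x h, hI]
      simp [hV0]
    · have hI : Set.Ici x ∩ Set.Icc (0 : ℝ) 1 = Set.Icc x 1 := by
        ext y
        simp only [Set.mem_inter_iff, Set.mem_Ici, Set.mem_Icc]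
        exact ⟨fun h => ⟨h.1, h.2.2⟩, fun h' => ⟨h'.1, h.trans h'.1, h'.2⟩⟩
      rw [hI, Real.volume_Icc]
      rcases le_or_gt x 1 with h1 | h1
      · rw [← hPV x ⟨h, h1⟩, ofReal_measureReal]
      · rw [hgt x h1, ENNReal.ofReal_of_nonpos (by linarith)]
  · have hall : ∀ S : Set ℝ, MeasurableSet S → ∫ ω in V ⁻¹' S, X ω ∂P = 0 := by
      have huniv : ∫ ω, X ω ∂P = 0 := by
        have h := hXV 0 ⟨le_rfl, zero_le_one⟩
        simpa [hV0] using h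
      refine MeasurableSpace.induction_on_inter
        (C := fun S _ => ∫ ω in V ⁻¹' S, X ω ∂P = 0)
        ((BorelSpace.measurable_eq (α := ℝ)).trans (borel_eq_generateFrom_Ici ℝ))
        isPiSystem_Ici (by simp) ?_ ?_ ?_
      · rintro _ ⟨x, rfl⟩
        exact hXV' x
      · intro S hS h
        have := integral_add_compl (hVm hS) hXi
        rw [h, huniv, zero_add] at this
        rwa [Set.preimage_compl]
      · intro S hd hS h
        rw [Set.preimage_iUnion, integral_iUnion (fun i => hVm (hS i))
          (fun i j hij => (hd hij).preimage V) hXi.integrableOn]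
        simp [h]
    refine (ae_eq_condExp_of_forall_setIntegral_eq hVm.comap_le hXi
      (fun s _ _ => integrableOn_zero) ?_ aestronglyMeasurable_zero).symm
    rintro _ ⟨S, hS, rfl⟩ _
    simp [hall S hS]
  · have h1 := hlow ω 0
    have h2 := hup ω 0
    simp only [m, ha0, pow_zero, mul_one] at h1 h2
    exact ⟨h1, h2⟩

/-! ### Values of (A) are values of (B) -/

lemma IsMeanIndepUniform.isMonotoneKB {Ω : Type*} [MeasurableSpace Ω] {P : Measure Ω}
    [IsProbabilityMeasure P] {N : ℕ} {X : Ω → EuclideanSpace ℝ (Fin N)} {V : Ω → ℝ}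
    (hX : Integrable X P) (hV : IsMeanIndepUniform P X V) :
    IsMonotoneKB P X fun t => (V ⁻¹' Set.Ioi t).indicator 1 := by
  have hm : ∀ t, MeasurableSet (V ⁻¹' Set.Ioi t) := fun t => hV.measurable measurableSet_Ioi
  refine ⟨fun t _ => measurable_one.indicator (hm t), ae_of_all _ fun ω s _ t _ hst => ?_,
    ae_of_all _ fun ω t _ => ?_, fun t ht => ?_, fun t _ => ?_⟩
  · exact Set.indicator_le_indicator_of_subset (Set.preimage_mono (Set.Ioi_subset_Ioi hst))
      (fun _ => zero_le_one) ω
  · by_cases h : ω ∈ V ⁻¹' Set.Ioi t <;> simp [h]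
  · rw [integral_indicator_one (hm t), measureReal_def,
      ← Measure.map_apply hV.measurable measurableSet_Ioi, hV.law_eq,
      Measure.restrict_apply measurableSet_Ioi]
    have : Set.Ioi t ∩ Set.Icc (0 : ℝ) 1 = Set.Ioc t 1 := by
      ext y
      simp only [Set.mem_inter_iff, Set.mem_Ioi, Set.mem_Icc, Set.mem_Ioc]
      exact ⟨fun h => ⟨h.1, h.2.2⟩, fun h => ⟨h.1, ht.1.trans h.1.le, h.2⟩⟩
    rw [this, Real.volume_Ioc, ENNReal.toReal_ofReal (by linarith [ht.2])]
  · have h1 := setIntegral_condExp hV.measurable.comap_le hX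
      (s := V ⁻¹' Set.Ioi t) ⟨_, measurableSet_Ioi, rfl⟩
    rw [integral_congr_ae (ae_restrict_of_ae hV.condExp_eq)] at h1
    calc _ = ∫ ω, (V ⁻¹' Set.Ioi t).indicator X ω ∂P := by
          congr 1; ext1 ω; by_cases h : ω ∈ V ⁻¹' Set.Ioi t <;> simp [h]
      _ = 0 := by rw [integral_indicator (hm t), ← h1]; simp

/-- Layer-cake formula: `∫₀¹ 1_{t < V} dt = V`, since `V ∈ [0,1]` almost surely. -/
lemma correlationValues_subset {Ω : Type*} [MeasurableSpace Ω] {P : Measure Ω}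
    [IsProbabilityMeasure P] {N : ℕ} {X : Ω → EuclideanSpace ℝ (Fin N)} (Y : Ω → ℝ)
    (hX : Integrable X P) : correlationValues P X Y ⊆ monotoneKBValues P X Y := by
  rintro _ ⟨V, hV, rfl⟩
  refine ⟨_, hV.isMonotoneKB hX, integral_congr_ae ?_⟩
  have h01 : ∀ᵐ ω ∂P, V ω ∈ Set.Icc (0 : ℝ) 1 := by
    refine ae_of_ae_map hV.measurable.aemeasurable ?_
    rw [hV.law_eq]
    exact ae_restrict_mem measurableSet_Icc
  filter_upwards [h01] with ω h
  rw [intervalIntegral.integral_mul_const, intervalIntegral.integral_of_le zero_le_one]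
  have : (fun t => (V ⁻¹' Set.Ioi t).indicator (1 : Ω → ℝ) ω) = (Set.Iio (V ω)).indicator 1 := by
    ext t
    by_cases ht : t < V ω <;> simp [Set.indicator, ht]
  rw [this, integral_indicator_one measurableSet_Iio, measureReal_restrict_apply measurableSet_Iio,
    show Set.Iio (V ω) ∩ Set.Ioc (0 : ℝ) 1 = Set.Ioo 0 (V ω) by
      ext y
      simp only [Set.mem_inter_iff, Set.mem_Iio, Set.mem_Ioc, Set.mem_Ioo]
      exact ⟨fun h' => ⟨h'.2.1, h'.1⟩, fun h' => ⟨h'.2, h'.1, h'.2.le.trans h.2⟩⟩,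
    Real.volume_real_Ioo_of_le h.1, sub_zero]

/-! ### Approximating values of (B) by values of (A) -/

/-- A Riemann sum of mesh `1 / K` of an antitone `[0,1]`-valued function is within `1 / K` of its
integral. -/
lemma AntitoneOn.abs_integral_sub_sum_le {g : ℝ → ℝ} (hg : AntitoneOn g (Set.Icc 0 1))
    (h0 : 0 ≤ g 1) (h1 : g 0 ≤ 1) {K : ℕ} (hK : 0 < K) :
    |(∫ t in (0 : ℝ)..1, g t) - 1 / K * ∑ k ∈ Finset.range K, g ((k + 1 : ℕ) / K)| ≤ 1 / K := by
  have hK0 : (0 : ℝ) < K := by exact_mod_cast hK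
  have hanti : AntitoneOn (fun t => g (t / K)) (Set.Icc (0 : ℝ) (0 + K)) := by
    intro s hs t ht hst
    rw [zero_add] at hs ht
    exact hg ⟨div_nonneg hs.1 hK0.le, div_le_one_of_le₀ hs.2 hK0.le⟩
      ⟨div_nonneg ht.1 hK0.le, div_le_one_of_le₀ ht.2 hK0.le⟩ (by gcongr)
  have hlow := hanti.sum_le_integral
  have hup := hanti.integral_le_sum
  simp only [zero_add] at hlow hup
  have hscale : ∫ t in (0 : ℝ)..K, g (t / K) = K * ∫ t in (0 : ℝ)..1, g t := by
    rw [intervalIntegral.integral_comp_div _ hK0.ne', zero_div, div_self hK0.ne', smul_eq_mul]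
  rw [hscale] at hlow hup
  -- Left and right sums enclose the integral, and their difference telescopes to `g 0 - g 1`.
  have htel : ∑ k ∈ Finset.range K, g ((k : ℕ) / K) -
      ∑ k ∈ Finset.range K, g ((k + 1 : ℕ) / K) ≤ 1 := by
    rw [← Finset.sum_sub_distrib, Finset.sum_range_sub' (fun k : ℕ => g ((k : ℝ) / K)),
      Nat.cast_zero, zero_div, div_self hK0.ne']
    linarith
  set S := ∑ k ∈ Finset.range K, g ((k + 1 : ℕ) / K)
  set I := ∫ t in (0 : ℝ)..1, g t
  have hI : I - 1 / K * S = 1 / K * (K * I - S) := by field_simp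
  rw [hI, abs_mul, abs_of_pos (by positivity : (0 : ℝ) < 1 / K)]
  exact mul_le_of_le_one_right (by positivity) (abs_le.mpr ⟨by linarith, by linarith⟩)

lemma IsMonotoneKB.abs_integral_sub_sum_le {Ω : Type*} [MeasurableSpace Ω] {P : Measure Ω} {N : ℕ}
    {X : Ω → EuclideanSpace ℝ (Fin N)} {U : ℝ → Ω → ℝ} (hU : IsMonotoneKB P X U) :
    ∀ᵐ ω ∂P, ∀ K : ℕ, 0 < K → |(∫ t in (0 : ℝ)..1, U t ω) -
      1 / K * ∑ k ∈ Finset.range K, U ((k + 1 : ℕ) / K) ω| ≤ 1 / K := by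
  filter_upwards [hU.antitone, hU.mem_Icc] with ω h1 h2 K hK
  exact h1.abs_integral_sub_sum_le (h2 1 ⟨zero_le_one, le_rfl⟩).1 (h2 0 ⟨le_rfl, zero_le_one⟩).2 hK

lemma natCast_div_mem_Icc {k K : ℕ} (h : k ≤ K) : (k / K : ℝ) ∈ Set.Icc (0 : ℝ) 1 :=
  ⟨by positivity, div_le_one_of_le₀ (by exact_mod_cast h) (by positivity)⟩

/-- Joint measurability in `(t, ω)` is not assumed; monotonicity in `t` makes the integral an a.e.
limit of Riemann sums, which are measurable. -/
lemma IsMonotoneKB.aestronglyMeasurable_integral {Ω : Type*} [MeasurableSpace Ω] {P : Measure Ω}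
    {N : ℕ} {X : Ω → EuclideanSpace ℝ (Fin N)} {U : ℝ → Ω → ℝ} (hU : IsMonotoneKB P X U) :
    AEStronglyMeasurable (fun ω => ∫ t in (0 : ℝ)..1, U t ω) P := by
  refine aestronglyMeasurable_of_tendsto_ae Filter.atTop
    (f := fun (n : ℕ) ω => 1 / ((n + 1 : ℕ) : ℝ) *
      ∑ k ∈ Finset.range (n + 1), U ((k + 1 : ℕ) / (n + 1 : ℕ)) ω) (fun n => ?_) ?_
  · refine (Measurable.const_mul (Finset.measurable_sum _ fun k hk => hU.measurable _
      (natCast_div_mem_Icc ?_)) _).aestronglyMeasurable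
    have := Finset.mem_range.mp hk
    omega
  · filter_upwards [hU.abs_integral_sub_sum_le] with ω h
    rw [tendsto_iff_dist_tendsto_zero]
    refine squeeze_zero (fun _ => dist_nonneg) (fun n => ?_)
      (tendsto_one_div_add_atTop_nhds_zero_nat (𝕜 := ℝ))
    have := h (n + 1) n.succ_pos
    rw [dist_comm, Real.dist_eq]
    exact_mod_cast this

/-- `U 0 ≤ 1` has mean 1. This starts the nested construction, whose level-zero set is the whole
space. -/
lemma IsMonotoneKB.ae_eq_one {Ω : Type*} [MeasurableSpace Ω] {P : Measure Ω}
    [IsProbabilityMeasure P] {N : ℕ} {X : Ω → EuclideanSpace ℝ (Fin N)} {U : ℝ → Ω → ℝ}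
    (hU : IsMonotoneKB P X U) : ∀ᵐ ω ∂P, U 0 ω = 1 := by
  have h0 : (0 : ℝ) ∈ Set.Icc (0 : ℝ) 1 := ⟨le_rfl, zero_le_one⟩
  have hi : Integrable (U 0) P := Integrable.of_bound (hU.measurable 0 h0).aestronglyMeasurable 1
    (hU.mem_Icc.mono fun ω h => by
      rw [Real.norm_of_nonneg (h 0 h0).1]; exact (h 0 h0).2)
  have hz : ∫ ω, (1 - U 0 ω) ∂P = 0 := by
    rw [integral_sub (integrable_const 1) hi, hU.integral_eq 0 h0]
    simp
  have := (integral_eq_zero_iff_of_nonneg_ae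
    (hU.mem_Icc.mono fun ω h => sub_nonneg.mpr (h 0 h0).2) ((integrable_const 1).sub hi)).mp hz
  filter_upwards [this] with ω h
  simp only [Pi.zero_apply] at h
  linarith

/-- A feasible family of the Koenker-Bassett problem is approximated by a mean-independent uniform
variable. -/
theorem IsMonotoneKB.exists_isMeanIndepUniform {Ω : Type*} [MeasurableSpace Ω] {P : Measure Ω}
    [IsProbabilityMeasure P] (hP : IsNonatomic P) {N : ℕ} {X : Ω → EuclideanSpace ℝ (Fin N)}
    {Y : Ω → ℝ} (hX : Measurable X) (hY : Measurable Y) {C D : ℝ} (hXC : ∀ᵐ ω ∂P, ‖X ω‖ ≤ C)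
    (hYD : ∀ᵐ ω ∂P, |Y ω| ≤ D) {U : ℝ → Ω → ℝ} (hU : IsMonotoneKB P X U) {K : ℕ} (hK : 0 < K) :
    ∃ V : Ω → ℝ, IsMeanIndepUniform P X V ∧
      |(∫ ω, (∫ t in (0 : ℝ)..1, U t ω * Y ω) ∂P) - ∫ ω, V ω * Y ω ∂P| ≤ 2 * D / K := by
  have hK0 : (0 : ℝ) < K := by exact_mod_cast hK
  have hD : 0 ≤ D := by
    obtain ⟨ω, h⟩ := hYD.exists
    exact (abs_nonneg _).trans h
  have hX2 : MemLp X 2 P := MemLp.of_bound hX.aestronglyMeasurable C hXC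
  have hXi : Integrable X P := hX2.integrable (by norm_num)
  have hY2 : MemLp Y 2 P := MemLp.of_bound hY.aestronglyMeasurable D hYD
  have hYi : Integrable Y P := hY2.integrable (by norm_num)
  have hXc : ∀ i, MemLp (fun ω => X ω i) 2 P := fun i =>
    hX2.of_le ((EuclideanSpace.proj i : EuclideanSpace ℝ (Fin N) →L[ℝ] ℝ).continuous
      |>.comp_aestronglyMeasurable hX2.1) (ae_of_all _ fun ω => PiLp.norm_apply_le (X ω) i)
  have hUm : ∀ k ≤ K, Measurable (U (k / K)) := fun k hk => hU.measurable _ (natCast_div_mem_Icc hk)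
  have hUb : ∀ k ≤ K, ∀ᵐ ω ∂P, ‖U (k / K) ω‖ ≤ 1 := fun k hk => hU.mem_Icc.mono fun ω h => by
    have := h _ (natCast_div_mem_Icc hk)
    rw [Real.norm_of_nonneg this.1]
    exact this.2
  -- The test function `1` fixes the law, `Y` the objective and the coordinates of `X` the
  -- mean-independence.
  let f : Option (Option (Fin N)) → Ω → ℝ := fun o =>
    o.elim (fun _ => 1) fun o => o.elim Y fun i ω => X ω i
  obtain ⟨c, hcm, hcK, hcf⟩ := hP.exists_superlevel_setIntegral_eq (f := f)
    (by rintro (_ | _ | i); exacts [memLp_const 1, hY2, hXc i]) K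
    (U := fun k => U (k / K)) hUm (by simpa using hU.ae_eq_one) (fun k hk => by
      filter_upwards [hU.mem_Icc, hU.antitone] with ω h1 h2
      refine ⟨(h1 _ (natCast_div_mem_Icc hk)).1,
        h2 (natCast_div_mem_Icc hk.le) (natCast_div_mem_Icc hk) ?_⟩
      gcongr
      omega)
  have hlev : ∀ k, MeasurableSet {ω | k ≤ c ω} := fun k => hcm measurableSet_Ici
  have hgrid : IsGridUniform P X K c := by
    refine ⟨hcm, hcK, fun k hk => ?_, fun k hk => ?_⟩
    · have h := hcf k hk none
      simp only [f, Option.elim, mul_one, hU.integral_eq _ (natCast_div_mem_Icc hk)] at h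
      simpa using h
    · ext i
      have h := hcf k hk (some (some i))
      simp only [f, Option.elim] at h
      have hUX : Integrable (fun ω => U (k / K) ω • X ω) P :=
        hXi.bdd_smul 1 (hUm k hk).aestronglyMeasurable (hUb k hk)
      rw [EuclideanSpace.integral_apply hXi.integrableOn, h,
        ← hU.integral_smul_eq _ (natCast_div_mem_Icc hk), EuclideanSpace.integral_apply hUX]
      simp
  obtain ⟨V, hV, hVc⟩ := hgrid.exists_isMeanIndepUniform hP hX hXC hK
  refine ⟨V, hV, ?_⟩
  have hVb : ∀ ω, |V ω - c ω / K| ≤ 1 / K := fun ω => by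
    have h := hVc ω
    rw [add_div] at h
    exact abs_le.mpr ⟨by linarith [h.1, one_div_pos.mpr hK0], by linarith [h.2]⟩
  have hcY : Integrable (fun ω => (c ω : ℝ) / K * Y ω) P :=
    hYi.bdd_mul (c := 1) ((measurable_from_nat.comp hcm).div_const _).aestronglyMeasurable
      (ae_of_all _ fun ω => by
        have := natCast_div_mem_Icc (hcK ω)
        rw [Real.norm_of_nonneg this.1]
        exact this.2)
  have hVY : Integrable (fun ω => V ω * Y ω) P := by
    have h : Integrable (fun ω => (V ω - c ω / K) * Y ω) P :=
      hYi.bdd_mul (c := 1 / K) (hV.measurable.sub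
        ((measurable_from_nat.comp hcm).div_const _)).aestronglyMeasurable (ae_of_all _ hVb)
    refine (h.add hcY).congr (ae_of_all _ fun ω => ?_)
    simp only [Pi.add_apply]
    ring
  let S : Ω → ℝ := fun ω => 1 / K * ∑ k ∈ Finset.range K, U ((k + 1 : ℕ) / K) ω
  have hSm : Measurable S := Measurable.const_mul (Finset.measurable_sum _ fun k hk =>
    hUm _ (Finset.mem_range.mp hk)) _
  have hUY : ∀ k < K, Integrable (fun ω => U ((k + 1 : ℕ) / K) ω * Y ω) P := fun k hk =>
    hYi.bdd_mul (c := 1) (hUm _ hk).aestronglyMeasurable (hUb _ hk)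
  have hSexp : ∀ ω, S ω * Y ω = 1 / K * ∑ k ∈ Finset.range K, U ((k + 1 : ℕ) / K) ω * Y ω :=
    fun ω => by rw [mul_assoc, Finset.sum_mul]
  have hSY : Integrable (fun ω => S ω * Y ω) P := by
    simp_rw [hSexp]
    exact (integrable_finsetSum _ fun k hk => hUY k (Finset.mem_range.mp hk)).const_mul _
  -- No error here: `c` is the sum of the indicators of `{k + 1 ≤ c}`, `k < K`, whose integrals
  -- against `Y` are those of `U ((k + 1) / K)`.
  have hScY : ∫ ω, S ω * Y ω ∂P = ∫ ω, (c ω : ℝ) / K * Y ω ∂P := by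
    have hcexp : ∀ ω, (c ω : ℝ) / K * Y ω =
        1 / K * ∑ k ∈ Finset.range K, {ω | k + 1 ≤ c ω}.indicator Y ω := fun ω => by
      have : ∑ k ∈ Finset.range K, {ω | k + 1 ≤ c ω}.indicator Y ω = c ω * Y ω := by
        simp only [Set.indicator_apply, Set.mem_ofPred_eq]
        rw [← Finset.sum_filter, Finset.sum_const, nsmul_eq_mul]
        congr 2
        rw [show (Finset.range K).filter (fun k => k + 1 ≤ c ω) = Finset.range (c ω) by
          ext k
          have := hcK ω
          simp only [Finset.mem_filter, Finset.mem_range]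
          omega, Finset.card_range]
      rw [this]; ring
    simp_rw [hSexp, hcexp]
    rw [integral_const_mul, integral_const_mul,
      integral_finsetSum _ fun k hk => hUY k (Finset.mem_range.mp hk),
      integral_finsetSum _ fun k _ => hYi.indicator (hlev (k + 1))]
    congr 1
    refine Finset.sum_congr rfl fun k hk => ?_
    rw [integral_indicator (hlev (k + 1))]
    exact (hcf (k + 1) (Finset.mem_range.mp hk) (some none)).symm
  let G : Ω → ℝ := fun ω => ∫ t in (0 : ℝ)..1, U t ω
  have hGS : ∀ᵐ ω ∂P, |G ω - S ω| ≤ 1 / K := hU.abs_integral_sub_sum_le.mono fun ω h => h K hK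
  have hGm : AEStronglyMeasurable G P := hU.aestronglyMeasurable_integral
  have hGSY : Integrable (fun ω => (G ω - S ω) * Y ω) P :=
    hYi.bdd_mul (c := 1 / K) (hGm.sub hSm.aestronglyMeasurable) hGS
  have hGY : Integrable (fun ω => G ω * Y ω) P :=
    (hGSY.add hSY).congr (ae_of_all _ fun ω => by simp only [Pi.add_apply]; ring)
  have hsmall : ∀ Z : Ω → ℝ, (∀ᵐ ω ∂P, |Z ω| ≤ 1 / K) → |∫ ω, Z ω * Y ω ∂P| ≤ D / K := by
    intro Z hZ
    have := norm_integral_le_of_norm_le_const (μ := P) (f := fun ω => Z ω * Y ω) (C := D / K) (by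
      filter_upwards [hZ, hYD] with ω h1 h2
      rw [norm_mul, Real.norm_eq_abs, Real.norm_eq_abs, div_eq_mul_one_div, mul_comm]
      exact mul_le_mul h2 h1 (abs_nonneg _) hD)
    simpa using this
  have e1 := hsmall _ hGS
  have e2 := hsmall _ (ae_of_all _ hVb)
  simp_rw [sub_mul] at e1 e2
  rw [integral_sub hGY hSY] at e1
  rw [integral_sub hVY hcY, ← hScY] at e2
  simp_rw [intervalIntegral.integral_mul_const]
  change |∫ ω, G ω * Y ω ∂P - _| ≤ _
  rw [abs_le] at e1 e2 ⊢
  rw [two_mul, add_div]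
  constructor <;> linarith [e1.1, e1.2, e2.1, e2.2]

/-! ### Finiteness and equality of the suprema -/

lemma bddAbove_monotoneKBValues {Ω : Type*} [MeasurableSpace Ω] {P : Measure Ω}
    [IsProbabilityMeasure P] {N : ℕ} (X : Ω → EuclideanSpace ℝ (Fin N)) {Y : Ω → ℝ} {D : ℝ}
    (hYD : ∀ᵐ ω ∂P, |Y ω| ≤ D) : BddAbove (monotoneKBValues P X Y) := by
  refine ⟨D, ?_⟩
  rintro _ ⟨U, hU, rfl⟩
  have := norm_integral_le_of_norm_le_const (μ := P)
    (f := fun ω => ∫ t in (0 : ℝ)..1, U t ω * Y ω) (C := D) (by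
      filter_upwards [hU.mem_Icc, hYD] with ω h1 h2
      have := intervalIntegral.norm_integral_le_of_norm_le_const (a := 0) (b := 1) (C := D)
        (f := fun t => U t ω * Y ω) (fun t ht => by
          rw [Set.uIoc_of_le zero_le_one] at ht
          have h := h1 t ⟨ht.1.le, ht.2⟩
          rw [norm_mul, Real.norm_of_nonneg h.1]
          exact (mul_le_of_le_one_left (norm_nonneg _) h.2).trans h2)
      simpa using this)
  exact (le_abs_self _).trans (by simpa using this)

lemma monotoneKBValues_nonempty {Ω : Type*} [MeasurableSpace Ω] {P : Measure Ω}
    [IsProbabilityMeasure P] {N : ℕ} {X : Ω → EuclideanSpace ℝ (Fin N)} (Y : Ω → ℝ)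
    (hX0 : ∫ ω, X ω ∂P = 0) : (monotoneKBValues P X Y).Nonempty := by
  refine ⟨_, fun t _ => 1 - t, ⟨fun t _ => measurable_const, ae_of_all _ fun ω s _ t _ hst => ?_,
    ae_of_all _ fun ω t ht => ⟨by linarith [ht.2], by linarith [ht.1]⟩, fun t _ => by simp,
    fun t _ => by rw [integral_smul, hX0, smul_zero]⟩, rfl⟩
  simp only
  linarith

theorem mainTheorem3 {Ω : Type*} [MeasurableSpace Ω] (P : Measure Ω) [IsProbabilityMeasure P]
    (hP : IsNonatomic P) {N : ℕ}
    (X : Ω → EuclideanSpace ℝ (Fin N)) (Y : Ω → ℝ)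
    (hX : Measurable X) (hY : Measurable Y)
    (hXb : ∃ C : ℝ, ∀ᵐ ω ∂P, ‖X ω‖ ≤ C) (hYb : ∃ C : ℝ, ∀ᵐ ω ∂P, |Y ω| ≤ C)
    (hX0 : ∫ ω, X ω ∂P = 0) :
    ((correlationValues P X Y).Nonempty ∧ BddAbove (correlationValues P X Y)) ∧
    ((monotoneKBValues P X Y).Nonempty ∧ BddAbove (monotoneKBValues P X Y)) ∧
    sSup (correlationValues P X Y) = sSup (monotoneKBValues P X Y) := by
  obtain ⟨C, hXC⟩ := hXb
  obtain ⟨D, hYD⟩ := hYb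
  have hsub : correlationValues P X Y ⊆ monotoneKBValues P X Y :=
    correlationValues_subset Y (Integrable.of_bound hX.aestronglyMeasurable C hXC)
  have hBne := monotoneKBValues_nonempty (P := P) Y hX0
  have hBbdd := bddAbove_monotoneKBValues X hYD
  have happrox : ∀ r ∈ monotoneKBValues P X Y, ∀ n : ℕ, ∃ s ∈ correlationValues P X Y,
      |r - s| ≤ 2 * D * (1 / ((n : ℝ) + 1)) := by
    rintro _ ⟨U, hU, rfl⟩ n
    obtain ⟨V, hV, h⟩ := hU.exists_isMeanIndepUniform hP hX hY hXC hYD n.succ_pos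
    refine ⟨_, ⟨V, hV, rfl⟩, ?_⟩
    rwa [mul_one_div, ← Nat.cast_succ]
  -- Admissibility in (A) is inherited from the deterministic family `1 - t` of (B) by
  -- approximation.
  have hAne : (correlationValues P X Y).Nonempty := by
    obtain ⟨r, hr⟩ := hBne
    obtain ⟨s, hs, -⟩ := happrox r hr 0
    exact ⟨s, hs⟩
  have hAbdd := hBbdd.mono hsub
  refine ⟨⟨hAne, hAbdd⟩, ⟨hBne, hBbdd⟩, le_antisymm (csSup_le_csSup hBbdd hAne hsub)
    (csSup_le hBne fun r hr => ?_)⟩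
  have hlim := ((tendsto_one_div_add_atTop_nhds_zero_nat (𝕜 := ℝ)).const_mul (2 * D)).const_add
    (sSup (correlationValues P X Y))
  rw [mul_zero, add_zero] at hlim
  refine ge_of_tendsto' hlim fun n => ?_
  obtain ⟨s, hs, h⟩ := happrox r hr n
  linarith [le_csSup hAbdd hs, (abs_le.mp h).2]
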